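/- All graphs are finite and simple; $v(H)$ and $e(H)$ denote the numbers of vertices and edges of $H$, and $\mathrm{ex}(n,H)$ is the maximum number of edges of an $n$-vertex graph containing no (not necessarily induced) copy of $H$. For $0\le\alpha<1$, a bipartite graph $H$ is called $\alpha$-Erdős–Simonovits good if there are constants $A,\beta>0$ such that for every $n$, every $n$-vertex graph $G$ with $e(G)=pn^2\ge An^{1+\alpha}$ contains at least $\beta p^{e(H)}n^{v(H)}$ copies of $H$. Let $0\le\alpha<1$, let $H$ be an $\alpha$-Erdős–Simonovits good graph, let $f=xy$ be an edge of $H$, and let $s\ge 1$ be an integer. Let $H^*$ be the graph formed by taking $s$ vertex-disjoint copies of $H$ and gluing them along $f$, that is, identifying all $s$ copies of $x$ into one vertex and all $s$ copies of $y$ into one vertex (so that the $s$ copies of $f$ become a single edge). Then there is a constant $C>0$, not depending on $n$, such that for all $n$, $$\mathrm{ex}(n,H)\le \mathrm{ex}(n,H^*)\le Cn^{1+\alpha}.$$ -/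

import Mathlib

/-- A finite bipartite graph `H` is `(α, C, β)`-Erdős–Simonovits good if every graph `G` with
`n` vertices and `p n ^ 2 ≥ C n ^ (1 + α)` edges has at least `β p ^ e(H) n ^ v(H)` copies of `H`.
Copies are counted as labelled copies (injective homomorphisms `H → G`); the number of subgraphs of
`G` isomorphic to `H` is this number divided by the number of automorphisms of `H`, so the
difference is absorbed in the constant `β`. -/
def IsErdosSimonovitsGoodWith {V : Type*} [Fintype V] (H : SimpleGraph V) (α C β : ℝ) : Prop :=
  H.IsBipartite ∧
    ∀ (n : ℕ) (G : SimpleGraph (Fin n)) (p : ℝ),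
      (G.edgeSet.ncard : ℝ) = p * (n : ℝ) ^ 2 →
      C * (n : ℝ) ^ (1 + α) ≤ p * (n : ℝ) ^ 2 →
      β * p ^ H.edgeSet.ncard * (n : ℝ) ^ Fintype.card V ≤ (G.labelledCopyCount H : ℝ)

/-- `H` is `α`-Erdős–Simonovits good if it is `(α, C, β)`-Erdős–Simonovits good for some positive
constants `C` and `β`. -/
def IsErdosSimonovitsGood {V : Type*} [Fintype V] (H : SimpleGraph V) (α : ℝ) : Prop :=
  ∃ C β : ℝ, 0 < C ∧ 0 < β ∧ IsErdosSimonovitsGoodWith H α C β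

/-- The vertices of the graph obtained from `s` copies of a graph on `V` by identifying, for each
endpoint `v` of `f`, all the copies of `v`: the two shared endpoints of `f`, and `s` disjoint copies
of the set of the other vertices. -/
abbrev GluedVertex {V : Type*} (f : Sym2 V) (s : ℕ) : Type _ :=
  {v : V // v ∈ f} ⊕ (Fin s × {v : V // v ∉ f})

open Classical in
/-- The inclusion of the vertices of the `i`-th copy into the glued vertex set. -/
noncomputable def gluedInclusion {V : Type*} (f : Sym2 V) (s : ℕ) (i : Fin s) :
    V ↪ GluedVertex f s where
  toFun v := if h : v ∈ f then Sum.inl ⟨v, h⟩ else Sum.inr (i, ⟨v, h⟩)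
  inj' := by
    intro a b hab
    by_cases ha : a ∈ f <;> by_cases hb : b ∈ f <;> simp_all

/-- The graph `H*` formed by taking `s` copies of `H` and gluing them along the (labelled) edge `f`:
the union of the images of `H` under the `s` inclusions. -/
noncomputable def glueAlongEdge {V : Type*} (H : SimpleGraph V) (f : Sym2 V) (s : ℕ) :
    SimpleGraph (GluedVertex f s) :=
  ⨆ i : Fin s, H.map (gluedInclusion f s i)

/-! Goodness is used only to get `ex(n, H) = O(n ^ (1 + α))`: a denser graph has a positive number
of copies of `H`. The upper bound for `H*` then follows by comparing it with `H`. In an `H*`-free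
graph, the copies of `H` that send `f` to a fixed edge `e` cannot include `s` copies pairwise
disjoint off `e`, so a bounded set `W e` disjoint from `e` meets them all. Take a uniformly random
vertex set `K` and keep the edges `e` with `e ⊆ K` and `K ∩ W e = ∅`. On average a constant fraction
survives. The surviving edges form an `H`-free graph on `K`: a copy of `H` there would send `f` to a
surviving `e`, so it would meet `W e`, which `K` avoids. -/

open Finset in
/-- An `α`-Erdős–Simonovits good graph has extremal number `O(n ^ (1 + α))`. -/
theorem IsErdosSimonovitsGood.exists_extremalNumber_le {V : Type*} [Fintype V]
    {H : SimpleGraph V} {α : ℝ} (hH : IsErdosSimonovitsGood H α) :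
    ∃ C : ℝ, 0 < C ∧ ∀ n : ℕ,
      (SimpleGraph.extremalNumber n H : ℝ) ≤ C * (n : ℝ) ^ (1 + α) := by
  classical
  obtain ⟨C, β, hC, hβ, -, h⟩ := hH
  refine ⟨C, hC, fun n => ?_⟩
  have hnn : 0 ≤ C * (n : ℝ) ^ (1 + α) := by positivity
  have key := SimpleGraph.extremalNumber_le_iff_of_nonneg (V := Fin n) H hnn
  rw [Fintype.card_fin] at key
  refine key.2 fun G _ hfree => ?_
  by_contra! hlt
  have hcard : G.edgeSet.ncard = #G.edgeFinset := by
    rw [← SimpleGraph.coe_edgeFinset, Set.ncard_coe_finset]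
  have hedge : (0 : ℝ) < G.edgeSet.ncard := by
    rw [hcard]; exact hnn.trans_lt hlt
  have hn : (0 : ℝ) < n := by
    rcases Nat.eq_zero_or_pos n with rfl | hn
    · have : G = ⊥ := Subsingleton.elim _ _
      subst this
      simp at hedge
    · exact_mod_cast hn
  have hp : (G.edgeSet.ncard : ℝ) = G.edgeSet.ncard / (n : ℝ) ^ 2 * (n : ℝ) ^ 2 := by
    field_simp
  have hcount := h n G _ hp (by rw [← hp, hcard]; exact hlt.le)
  rw [SimpleGraph.labelledCopyCount_eq_zero.2 hfree, Nat.cast_zero] at hcount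
  have : 0 < β * (G.edgeSet.ncard / (n : ℝ) ^ 2) ^ H.edgeSet.ncard *
      (n : ℝ) ^ Fintype.card V := by positivity
  linarith

/-- Each of the glued copies is a copy of the original graph. -/
theorem isContained_glueAlongEdge {V : Type*} (H : SimpleGraph V) (f : Sym2 V) {s : ℕ}
    (hs : 1 ≤ s) : H.IsContained (glueAlongEdge H f s) :=
  ⟨⟨⟨gluedInclusion f s ⟨0, hs⟩, fun {u v} huv => by
    rw [glueAlongEdge, SimpleGraph.iSup_adj]
    exact ⟨⟨0, hs⟩, (SimpleGraph.map_adj _ _ _ _).2 ⟨u, v, huv, rfl, rfl⟩⟩⟩,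
    (gluedInclusion f s ⟨0, hs⟩).injective⟩⟩

/-- Copies of `H` that agree on `f` and are otherwise disjoint form a copy of `glueAlongEdge`. -/
theorem glueAlongEdge_isContained {V U : Type*} {H : SimpleGraph V} {G : SimpleGraph U}
    {f : Sym2 V} {s : ℕ} (hs : 1 ≤ s) (φ : Fin s → SimpleGraph.Copy H G)
    (hagree : ∀ i j, ∀ v ∈ f, φ i v = φ j v)
    (hdisj : ∀ i j, i ≠ j → ∀ u v, u ∉ f → v ∉ f → φ i u ≠ φ j v) :
    (glueAlongEdge H f s).IsContained G := by
  let g : GluedVertex f s → U :=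
    Sum.elim (fun v => φ ⟨0, hs⟩ v) (fun q => φ q.1 q.2)
  have hg : ∀ i v, g (gluedInclusion f s i v) = φ i v := by
    intro i v
    by_cases hv : v ∈ f
    · have : gluedInclusion f s i v = Sum.inl ⟨v, hv⟩ := dif_pos hv
      rw [this]
      exact hagree _ _ v hv
    · have : gluedInclusion f s i v = Sum.inr (i, ⟨v, hv⟩) := dif_neg hv
      rw [this]
      rfl
  have hmixed : ∀ u ∈ f, ∀ i, ∀ v ∉ f, φ ⟨0, hs⟩ u ≠ φ i v := by
    intro u hu i v hv h
    rw [hagree _ i u hu] at h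
    exact hv ((φ i).injective h ▸ hu)
  refine ⟨⟨⟨g, ?_⟩, ?_⟩⟩
  · intro a b hab
    rw [glueAlongEdge, SimpleGraph.iSup_adj] at hab
    obtain ⟨i, hi⟩ := hab
    obtain ⟨u, v, huv, rfl, rfl⟩ := (SimpleGraph.map_adj _ _ _ _).1 hi
    rw [hg, hg]
    exact (φ i).toHom.map_adj huv
  · rintro (⟨u, hu⟩ | ⟨i, u, hu⟩) (⟨v, hv⟩ | ⟨j, v, hv⟩) h
    · have : u = v := (φ ⟨0, hs⟩).injective h
      subst this; rfl
    · exact absurd h (hmixed u hu j v hv)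
    · exact absurd h.symm (hmixed v hv i u hu)
    · by_cases hij : i = j
      · subst hij
        have : u = v := (φ i).injective h
        subst this; rfl
      · exact absurd h (hdisj i j hij u v hu hv)

open Finset in
/-- In a graph without `glueAlongEdge H s(x, y) s`, the copies of `H` with prescribed images of `x`
and `y` are all hit, away from these images, by a set of bounded size. -/
theorem exists_hittingSet_of_glueAlongEdge_free {V U : Type*} [Fintype V] {H : SimpleGraph V}
    {G : SimpleGraph U} {x y : V} {s : ℕ} (hs : 1 ≤ s)
    (hfree : (glueAlongEdge H s(x, y) s).Free G) (a b : U) :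
    ∃ W : Finset U, #W ≤ s * Fintype.card V ∧ a ∉ W ∧ b ∉ W ∧
      ∀ φ : SimpleGraph.Copy H G, φ x = a → φ y = b → ∃ v, v ∉ s(x, y) ∧ φ v ∈ W := by
  classical
  by_contra! hcon
  -- Greedy construction: the images off `f` of the copies chosen so far form a set too small to be
  -- a hitting set, so some further copy avoids it.
  have family : ∀ k ≤ s, ∃ φ : Fin k → SimpleGraph.Copy H G,
      (∀ i, φ i x = a ∧ φ i y = b) ∧
      ∀ i j, i ≠ j → ∀ u v, u ∉ s(x, y) → v ∉ s(x, y) → φ i u ≠ φ j v := by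
    intro k
    induction k with
    | zero => exact fun _ => ⟨Fin.elim0, fun i => i.elim0, fun i => i.elim0⟩
    | succ k ih =>
      intro hk
      obtain ⟨φ, hφ, hdisj⟩ := ih (by omega)
      let W : Finset U :=
        (univ.filter fun q : Fin k × V => q.2 ∉ s(x, y)).image fun q => φ q.1 q.2
      have hW : ∀ i, ∀ v ∉ s(x, y), φ i v ∈ W := fun i v hv =>
        mem_image.2 ⟨(i, v), by simpa using hv, rfl⟩
      have hcard : #W ≤ s * Fintype.card V := by
        refine card_image_le.trans ((card_filter_le _ _).trans ?_)
        rw [card_univ, Fintype.card_prod, Fintype.card_fin]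
        exact Nat.mul_le_mul_right _ (by omega)
      have ha : a ∉ W := by
        intro h
        obtain ⟨⟨i, v⟩, hv, h⟩ := mem_image.1 h
        have : v = x := (φ i).injective (h.trans (hφ i).1.symm)
        simp [this] at hv
      have hb : b ∉ W := by
        intro h
        obtain ⟨⟨i, v⟩, hv, h⟩ := mem_image.1 h
        have : v = y := (φ i).injective (h.trans (hφ i).2.symm)
        simp [this] at hv
      obtain ⟨ψ, hx, hy, hψ⟩ := hcon W hcard ha hb
      refine ⟨Fin.cons ψ φ, fun i => ?_, fun i j => ?_⟩
      · cases i using Fin.cases with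
        | zero => exact ⟨hx, hy⟩
        | succ i => simpa using hφ i
      · cases i using Fin.cases with
        | zero =>
          cases j using Fin.cases with
          | zero => exact fun h => absurd rfl h
          | succ j =>
            intro _ u v hu hv h
            simp only [Fin.cons_zero, Fin.cons_succ] at h
            exact hψ u hu (h ▸ hW j v hv)
        | succ i =>
          cases j using Fin.cases with
          | zero =>
            intro _ u v hu hv h
            simp only [Fin.cons_zero, Fin.cons_succ] at h
            exact hψ v hv (h ▸ hW i u hu)
          | succ j =>
            intro hij u v hu hv
            simpa using hdisj i j (fun h => hij (h ▸ rfl)) u v hu hv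
  obtain ⟨φ, hφ, hdisj⟩ := family s le_rfl
  refine hfree (glueAlongEdge_isContained hs φ (fun i j v hv => ?_) hdisj)
  rcases Sym2.mem_iff.1 hv with rfl | rfl
  · rw [(hφ i).1, (hφ j).1]
  · rw [(hφ i).2, (hφ j).2]

open Finset in
/-- In a graph without `glueAlongEdge H f s`, the copies of `H` mapping `f` to a given edge are all
hit, away from the edge, by a set of bounded size. -/
theorem exists_hittingSet_of_map_eq {V U : Type*} [Fintype V] {H : SimpleGraph V}
    {G : SimpleGraph U} {f : Sym2 V} {s : ℕ} (hs : 1 ≤ s)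
    (hfree : (glueAlongEdge H f s).Free G) (e : Sym2 U) :
    ∃ W : Finset U, #W ≤ 2 * (s * Fintype.card V) ∧ (∀ a ∈ e, a ∉ W) ∧
      ∀ φ : SimpleGraph.Copy H G, f.map φ = e → ∃ v, v ∉ f ∧ φ v ∈ W := by
  classical
  induction f with | _ x y
  induction e with | _ a b
  -- A copy can send `f` to `e` in either orientation, hence two hitting sets and the factor 2.
  obtain ⟨W₁, hc₁, ha₁, hb₁, h₁⟩ := exists_hittingSet_of_glueAlongEdge_free hs hfree a b
  obtain ⟨W₂, hc₂, hb₂, ha₂, h₂⟩ := exists_hittingSet_of_glueAlongEdge_free hs hfree b a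
  refine ⟨W₁ ∪ W₂, (card_union_le _ _).trans (by omega), ?_, fun φ hφ => ?_⟩
  · intro c hc
    rcases Sym2.mem_iff.1 hc with rfl | rfl <;> simp [*]
  · rw [Sym2.map_mk, Sym2.eq_iff] at hφ
    rcases hφ with ⟨hx, hy⟩ | ⟨hx, hy⟩
    · obtain ⟨v, hv, h⟩ := h₁ φ hx hy
      exact ⟨v, hv, mem_union_left _ h⟩
    · obtain ⟨v, hv, h⟩ := h₂ φ hx hy
      exact ⟨v, hv, mem_union_right _ h⟩

open Finset in
/-- If each edge `e` is assigned a set `W e` of at most `M` vertices off `e`, then some vertex set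
`K` contains, and avoids the assigned sets of, at least a `2 ^ -(M + 2)` fraction of the edges. -/
theorem exists_finset_card_le_mul_card_filter {U : Type*} [Fintype U] [DecidableEq U]
    (E : Finset (Sym2 U)) (W : Sym2 U → Finset U) (M : ℕ) (hM : ∀ e, #(W e) ≤ M)
    (hW : ∀ e, ∀ a ∈ e, a ∉ W e) :
    ∃ K : Finset U, #E ≤ 2 ^ (M + 2) * #{e ∈ E | e.toFinset ⊆ K ∧ K ⊆ (W e)ᶜ} := by
  -- Average over all `K`. Those suitable for `e` form the interval from `e` to `(W e)ᶜ`, with at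
  -- least `2 ^ (|U| - M - 2)` members: at most `M + 2` vertices have their membership prescribed.
  by_contra! hcon
  have hlt : ∑ K : Finset U, 2 ^ (M + 2) * #{e ∈ E | e.toFinset ⊆ K ∧ K ⊆ (W e)ᶜ} <
      ∑ _K : Finset U, #E := sum_lt_sum_of_nonempty univ_nonempty fun K _ => hcon K
  have hswap : ∑ K : Finset U, #{e ∈ E | e.toFinset ⊆ K ∧ K ⊆ (W e)ᶜ} =
      ∑ e ∈ E, #(Icc e.toFinset (W e)ᶜ) := by
    simp_rw [card_filter]
    rw [sum_comm]
    refine sum_congr rfl fun e _ => ?_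
    rw [← card_filter]
    congr 1
    ext K
    simp
  have hIcc : ∀ e, 2 ^ Fintype.card U ≤ 2 ^ (M + 2) * #(Icc e.toFinset (W e)ᶜ) := by
    intro e
    have hsub : e.toFinset ⊆ (W e)ᶜ := fun a ha =>
      mem_compl.2 (hW e a (Sym2.mem_toFinset.1 ha))
    have h2 : #e.toFinset ≤ 2 := by
      rw [Sym2.card_toFinset]; split_ifs <;> omega
    rw [card_Icc_finset hsub, card_compl, ← pow_add]
    have := hM e
    exact Nat.pow_le_pow_right (by norm_num) (by omega)
  rw [← mul_sum, hswap, mul_sum, sum_const, card_univ, Fintype.card_finset, smul_eq_mul] at hlt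
  have hge : ∑ _e ∈ E, 2 ^ Fintype.card U ≤
      ∑ e ∈ E, 2 ^ (M + 2) * #(Icc e.toFinset (W e)ᶜ) := sum_le_sum fun e _ => hIcc e
  rw [sum_const, smul_eq_mul] at hge
  rw [mul_comm] at hlt
  omega

open Finset in
/-- Up to a constant factor, a graph without `glueAlongEdge H f s` has no more edges than some
`H`-free graph on at most as many vertices. -/
theorem card_edgeFinset_le_of_glueAlongEdge_free {V U : Type*} [Fintype V] [Fintype U]
    {H : SimpleGraph V} {G : SimpleGraph U} [DecidableRel G.Adj] {f : Sym2 V}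
    (hf : f ∈ H.edgeSet) {s : ℕ} (hs : 1 ≤ s) (hfree : (glueAlongEdge H f s).Free G) :
    ∃ m ≤ Fintype.card U, #G.edgeFinset ≤
      2 ^ (2 * (s * Fintype.card V) + 2) * SimpleGraph.extremalNumber m H := by
  classical
  choose W hcard hoff hhit using exists_hittingSet_of_map_eq (f := f) hs hfree
  obtain ⟨K, hK⟩ := exists_finset_card_le_mul_card_filter G.edgeFinset W _ hcard hoff
  set S : Finset (Sym2 U) := {e ∈ G.edgeFinset | e.toFinset ⊆ K ∧ K ⊆ (W e)ᶜ}
  let G' : SimpleGraph U := SimpleGraph.fromEdgeSet S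
  have hG' : G'.edgeFinset = S := by
    ext e
    simp only [G', SimpleGraph.mem_edgeFinset, SimpleGraph.edgeSet_fromEdgeSet, Set.mem_sdiff,
      mem_coe, and_iff_left_iff_imp]
    intro he
    exact G.not_isDiag_of_mem_edgeFinset (mem_filter.1 he).1
  have hle : G' ≤ G := by
    rw [← SimpleGraph.edgeFinset_subset_edgeFinset, hG']
    exact filter_subset _ _
  have hsupp : G'.support ⊆ (K : Set U) := by
    rintro a ⟨b, hab⟩
    have he : s(a, b) ∈ S := by rw [← hG']; simpa using hab
    exact (mem_filter.1 he).2.1 (by simp)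
  -- Inducing on `K` puts every vertex of the copy in `K`, including images of isolated vertices of
  -- `H`.
  have hfree' : H.Free (G'.induce (K : Set U)) := by
    rintro ⟨φ⟩
    let ι : SimpleGraph.Copy H G' := (SimpleGraph.Copy.induce G' (K : Set U)).comp φ
    let ψ : SimpleGraph.Copy H G := (SimpleGraph.Copy.ofLE G' G hle).comp ι
    have he : f.map ψ ∈ S := by
      rw [← hG', SimpleGraph.mem_edgeFinset]
      exact ι.toHom.map_mem_edgeSet hf
    obtain ⟨v, -, hv⟩ := hhit (f.map ψ) ψ rfl
    have hvK : ψ v ∈ K := (φ v).2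
    exact mem_compl.1 ((mem_filter.1 he).2.2 hvK) hv
  refine ⟨#K, card_le_univ K, hK.trans (Nat.mul_le_mul_left _ ?_)⟩
  have hedges : #(G'.induce (K : Set U)).edgeFinset = #S := by
    refine Eq.trans ?_ (congrArg card hG')
    convert! SimpleGraph.card_edgeFinset_induce_of_support_subset hsupp
  have hext := SimpleGraph.card_edgeFinset_le_extremalNumber hfree'
  rw [hedges] at hext
  simpa using hext

theorem corollary1p8 {V : Type*} [Fintype V] (H : SimpleGraph V) (α : ℝ) (hα0 : 0 ≤ α)
    (hα1 : α < 1) (hH : IsErdosSimonovitsGood H α) (f : Sym2 V) (hf : f ∈ H.edgeSet)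
    (s : ℕ) (hs : 1 ≤ s) :
    ∃ C : ℝ, 0 < C ∧ ∀ n : ℕ,
      SimpleGraph.extremalNumber n H ≤ SimpleGraph.extremalNumber n (glueAlongEdge H f s) ∧
      (SimpleGraph.extremalNumber n (glueAlongEdge H f s) : ℝ) ≤ C * (n : ℝ) ^ (1 + α) := by
  classical
  obtain ⟨C, hC, hex⟩ := hH.exists_extremalNumber_le
  refine ⟨2 ^ (2 * (s * Fintype.card V) + 2) * C, by positivity, fun n =>
    ⟨(isContained_glueAlongEdge H f hs).extremalNumber_le, ?_⟩⟩
  have key := SimpleGraph.extremalNumber_le_iff_of_nonneg (V := Fin n) (glueAlongEdge H f s)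
    (m := 2 ^ (2 * (s * Fintype.card V) + 2) * C * (n : ℝ) ^ (1 + α)) (by positivity)
  rw [Fintype.card_fin] at key
  refine key.2 fun G _ hfree => ?_
  obtain ⟨m, hm, hcard⟩ := card_edgeFinset_le_of_glueAlongEdge_free hf hs hfree
  rw [Fintype.card_fin] at hm
  calc (G.edgeFinset.card : ℝ)
      ≤ 2 ^ (2 * (s * Fintype.card V) + 2) * (SimpleGraph.extremalNumber m H : ℝ) := by
        exact_mod_cast hcard
    _ ≤ 2 ^ (2 * (s * Fintype.card V) + 2) * (C * (m : ℝ) ^ (1 + α)) := by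
        gcongr; exact hex m
    -- Here `m ≤ n` and the exponent `1 + α` is nonnegative.
    _ ≤ 2 ^ (2 * (s * Fintype.card V) + 2) * (C * (n : ℝ) ^ (1 + α)) := by
        gcongr
    _ = _ := by ring
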